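/- Let $S$ be a finite set of integers. For a permutation $\sigma$ of $S$, let $\Phi(\sigma)$ be the linear ordering of $S$ obtained by writing each cycle of $\sigma$ (fixed points included) as $m,\sigma(m),\sigma^2(m),\dots$ starting with its largest element $m$, arranging the cycles in increasing order of their largest elements, and erasing the parentheses; $\Phi$ is a bijection from the permutations of $S$ to the linear orderings of $S$. The watershed of a sequence $\pi_1,\dots,\pi_{2n}$ of distinct integers is the unique $k\in\{0,1,\dots,n\}$ such that all cycle lengths of $$\Phi^{-1}(\pi_{2k},\pi_{2k-1},\dots,\pi_1)\quad\text{and}\quad \Phi^{-1}(\pi_{2k+1},\pi_{2k+2},\dots,\pi_{2n})$$ are even (the empty permutation has this property). Let $n\ge 0$ and $0\le k\le n$. Then the number of linear orderings of $\{1,2,\dots,2n\}$ with watershed $k$ is $$\binom{2n}{2k}\,\bigl((2k-1)!!\bigr)^2\,\bigl((2n-2k-1)!!\bigr)^2,$$ where $(-1)!!=1$. Moreover, this number equals the number of permutations of $\{1,2,\dots,2n\}$ whose even-length cycles have total length $2k$. -/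

import Mathlib

open scoped Nat

/-- The Foata--Rényi map `Φ`: each cycle of `σ` (fixed points are cycles of length one) is written
with its largest element `m` first, as `m, σ m, σ (σ m), …`; the cycles are arranged in increasing
order of their largest elements, and the resulting lists are concatenated. -/
noncomputable def foata {α : Type*} [LinearOrder α] [Fintype α] (σ : Equiv.Perm α) : List α :=
  ((Finset.univ.filter fun m : α => ∀ y, σ.SameCycle m y → y ≤ m).sort (· ≤ ·)).flatMap
    fun m => List.iterate σ m (Function.minimalPeriod σ m)

/-- All cycle lengths of `σ` are even. The parts of `σ.partition` are the lengths of all the cycles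
of `σ`, with a part `1` for every fixed point. -/
def AllCyclesEven {α : Type*} [Fintype α] [DecidableEq α] (σ : Equiv.Perm α) : Prop :=
  ∀ c ∈ σ.partition.parts, Even c

/-- All cycle lengths of `Φ⁻¹(ρ)` are even, for a sequence `ρ` of distinct integers: the
permutation `σ` of the set of entries of `ρ` with `Φ(σ) = ρ` has only even cycles. -/
def FoataInvEven (ρ : List ℤ) : Prop :=
  ∃ σ : Equiv.Perm ρ.toFinset,
    (foata σ).map Subtype.val = ρ ∧ AllCyclesEven σ

/-- The condition on `k` in the definition of the watershed of `π₁, …, π_{2n}`: one has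
`0 ≤ k ≤ n`, and `Φ⁻¹(π_{2k}, …, π₁)` and `Φ⁻¹(π_{2k+1}, …, π_{2n})` have only even cycles. -/
def EvenSplit (π : List ℤ) (k : ℕ) : Prop :=
  2 * k ≤ π.length ∧ FoataInvEven (π.take (2 * k)).reverse ∧ FoataInvEven (π.drop (2 * k))

/-- `k` is the watershed of `π`: the unique number that satisfies `EvenSplit π`. -/
def IsWatershed (π : List ℤ) (k : ℕ) : Prop :=
  EvenSplit π k ∧ ∀ j, EvenSplit π j → j = k

/-- `π` is a linear ordering of the finite set `S`: it lists every element exactly once. -/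
def IsLinearOrdering (S : Finset ℤ) (π : List ℤ) : Prop :=
  π.Nodup ∧ π.toFinset = S

/-- The total length of the cycles of `σ` that have even length. -/
def evenCyclesTotalLength {α : Type*} [Fintype α] [DecidableEq α] (σ : Equiv.Perm α) : ℕ :=
  (σ.partition.parts.filter Even).sum

/-! Cut a word just before each left-to-right maximum. Under `Φ` the pieces are exactly the cycles
(`blockLengths_foata`), and `Φ` is a bijection (`image_foata`), so every condition on cycle lengths
becomes a condition on block lengths.

At most one `k` satisfies `EvenSplit π`, by a parity argument at the maximum of the segment between
two putative cuts (`EvenSplit.not_lt`). Counting watershed `k` therefore means counting even splits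
at `2k`: choose the set of the first `2k` letters, then a word with only even blocks on it and
another on its complement.

The numbers of words come from one generating function (`blockPoly_eq`). With `t` marking the total
length of the even blocks, the exponential generating function is `E(tx) O(x)`, where `E = (1 -
x²)^(-1/2)` accounts for even cycles and `O = (1 + x) E` for odd ones. In degree `2m` both have
coefficient `((2m-1)!!)² / (2m)!`. Hence `2m` letters carry `((2m-1)!!)²` words with only even
blocks, and the coefficient of `t^(2k)` gives the same product for permutations whose even cycles
have total length `2k`. -/

/-! ### Words and their blocks -/

section Blocks

variable {α : Type*} [LinearOrder α]

/-- The lengths of the blocks into which the left-to-right maxima cut the word `l.reverse`, the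
last block first. The number `L` counts entries already assigned to the last block. -/
def blockLengths : ℕ → List α → List ℕ
  | _, [] => []
  | L, x :: l => if ∃ z ∈ l, x < z then blockLengths (L + 1) l else (L + 1) :: blockLengths 0 l

/-- No letter of `u` can close a block, since `m` comes later and is larger; `m` itself closes one.
-/
theorem blockLengths_append_cons {m : α} (u v : List α) (L : ℕ) (hu : ∀ x ∈ u, x < m)
    (hv : ∀ y ∈ v, y < m) :
    blockLengths L (u ++ m :: v) = (L + u.length + 1) :: blockLengths 0 v := by
  induction u generalizing L with
  | nil =>
    have : ¬ ∃ z ∈ v, m < z := by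
      rintro ⟨z, hz, h⟩
      exact lt_asymm h (hv z hz)
    simp [blockLengths, this]
  | cons x u ih =>
    have : ∃ z ∈ u ++ m :: v, x < z := ⟨m, by simp, hu x (by simp)⟩
    simp only [List.cons_append, blockLengths, if_pos this]
    rw [ih _ (fun y hy => hu y (by simp [hy]))]
    simp only [List.length_cons]
    congr 1
    omega

theorem blockLengths_map {β : Type*} [LinearOrder β] {f : α → β} (hf : StrictMono f) (L : ℕ)
    (l : List α) : blockLengths L (l.map f) = blockLengths L l := by
  induction l generalizing L with
  | nil => rfl
  | cons x l ih => simp [blockLengths, ih, hf.lt_iff_lt]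

theorem sum_blockLengths_cons (x : α) (l : List α) (L : ℕ) :
    (blockLengths L (x :: l)).sum = L + (x :: l).length := by
  induction l generalizing L x with
  | nil => simp [blockLengths]
  | cons y l ih =>
    rw [blockLengths]
    split_ifs with h
    · rw [ih]; simp only [List.length_cons]; omega
    · rw [List.sum_cons, ih]; simp only [List.length_cons]; omega

theorem sum_blockLengths (l : List α) : (blockLengths 0 l).sum = l.length := by
  cases l with
  | nil => rfl
  | cons x l => simp [sum_blockLengths_cons]

/-- A block closes at `m`, so the letters up to `m` form complete blocks, all even. The letters of
`u` may be larger than `m`; this is what lets the uniqueness proof work with a local maximum. -/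
theorem even_of_blockLengths_even {m : α} (u v : List α) (L : ℕ) (hv : ∀ y ∈ v, y < m)
    (h : ∀ c ∈ blockLengths L (u ++ m :: v), Even c) : Even (L + u.length + 1) := by
  induction u generalizing L with
  | nil =>
    have hm : ¬ ∃ z ∈ v, m < z := by
      rintro ⟨z, hz, h⟩
      exact lt_asymm h (hv z hz)
    simp only [List.nil_append, blockLengths, if_neg hm] at h
    exact h _ (by simp)
  | cons x u ih =>
    simp only [List.cons_append, blockLengths] at h
    split_ifs at h with hx
    · have := ih _ h
      rw [List.length_cons]
      convert this using 1
      omega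
    · have h1 := h (L + 1) (by simp)
      have h2 := ih 0 (fun c hc => h c (by simp [hc]))
      rw [List.length_cons,
        show L + (u.length + 1) + 1 = L + 1 + (0 + u.length + 1) by omega]
      exact h1.add h2

/-- Every block of the word `l.reverse` has even length. -/
def AllBlocksEven (l : List α) : Prop := ∀ c ∈ blockLengths 0 l, Even c

instance : DecidablePred (AllBlocksEven (α := α)) :=
  fun l => inferInstanceAs (Decidable (∀ c ∈ blockLengths 0 l, Even c))

/-- The total length of the even blocks. -/
def evenBlocksLength (L : ℕ) (l : List α) : ℕ := ((blockLengths L l).filter (Even ·)).sum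

theorem List.sum_filter_even_eq_sum_iff (l : List ℕ) :
    (l.filter (Even ·)).sum = l.sum ↔ ∀ c ∈ l, Even c := by
  induction l with
  | nil => simp
  | cons c l ih =>
    have hle : (l.filter (Even ·)).sum ≤ l.sum := (List.filter_sublist).sum_le_sum (by simp)
    by_cases hc : Even c
    · simp [hc, ih]
    · have : 0 < c := Nat.pos_of_ne_zero (by rintro rfl; simp at hc)
      simp only [hc, decide_false, Bool.false_eq_true, not_false_eq_true, List.filter_cons_of_neg,
        List.sum_cons, List.mem_cons, forall_eq_or_imp, false_and, iff_false]
      omega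

theorem evenBlocksLength_eq_length_iff (l : List α) :
    evenBlocksLength 0 l = l.length ↔ AllBlocksEven l := by
  rw [AllBlocksEven, ← List.sum_filter_even_eq_sum_iff, sum_blockLengths, evenBlocksLength]

/-- The words that list every element of `S` exactly once. -/
noncomputable def orderings (S : Finset α) : Finset (List α) := S.toList.permutations.toFinset

theorem mem_orderings {S : Finset α} {l : List α} :
    l ∈ orderings S ↔ l.Nodup ∧ l.toFinset = S := by
  rw [orderings, List.mem_toFinset, List.mem_permutations]
  constructor
  · intro h
    exact ⟨h.nodup_iff.mpr S.nodup_toList, by rw [List.toFinset_eq_of_perm _ _ h]; simp⟩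
  · rintro ⟨h, rfl⟩
    exact (List.toFinset_toList h).symm

theorem card_orderings (S : Finset α) : (orderings S).card = S.card ! := by
  rw [orderings, List.toFinset_card_of_nodup (List.nodup_permutations _ S.nodup_toList),
    List.length_permutations, Finset.length_toList]

theorem length_of_mem_orderings {S : Finset α} {l : List α} (h : l ∈ orderings S) :
    l.length = S.card := by
  rw [mem_orderings] at h
  rw [← h.2, List.toFinset_card_of_nodup h.1]

theorem reverse_mem_orderings {S : Finset α} {l : List α} :
    l.reverse ∈ orderings S ↔ l ∈ orderings S := by
  simp [mem_orderings]

theorem sum_orderings {M : Type*} [AddCommMonoid M] (S : Finset α) (hS : S.Nonempty)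
    (F : List α → M) :
    ∑ l ∈ orderings S, F l = ∑ x ∈ S, ∑ l ∈ orderings (S.erase x), F (x :: l) := by
  rw [Finset.sum_sigma']
  symm
  refine Finset.sum_bij (fun p _ => p.1 :: p.2) ?_ ?_ ?_ ?_
  · rintro ⟨x, l⟩ h
    simp only [Finset.mem_sigma, mem_orderings] at h
    obtain ⟨hx, hl, he⟩ := h
    rw [mem_orderings, List.nodup_cons, List.toFinset_cons, he, Finset.insert_erase hx]
    refine ⟨⟨fun h => ?_, hl⟩, rfl⟩
    rw [← List.mem_toFinset, he] at h
    simp at h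
  · rintro ⟨x, l⟩ - ⟨y, l'⟩ - h
    simp only [List.cons.injEq] at h
    obtain ⟨rfl, rfl⟩ := h
    rfl
  · intro l hl
    rw [mem_orderings] at hl
    obtain ⟨hn, he⟩ := hl
    cases l with
    | nil => simp [← he] at hS
    | cons x l =>
      rw [List.nodup_cons] at hn
      refine ⟨⟨x, l⟩, ?_, rfl⟩
      rw [Finset.mem_sigma, mem_orderings]
      refine ⟨by simp [← he], hn.2, ?_⟩
      rw [← he, List.toFinset_cons, Finset.erase_insert]
      simpa using hn.1
  · intros; rfl

end Blocks

/-! ### The recursion for the generating polynomial, and the series of even cycles -/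

section GeneratingPolynomial

open Polynomial

/-- The weight of a block of length `L`: its length is recorded if it is even. -/
noncomputable def blockWeight (L : ℕ) : ℚ[X] := if Even L then X ^ L else 1

/-- The generating polynomial of `evenBlocksLength L` over the orderings of an `N`-element set. -/
noncomputable def blockPoly : ℕ → ℕ → ℚ[X]
  | 0, _ => 1
  | N + 1, L => N * blockPoly N (L + 1) + blockWeight (L + 1) * blockPoly N 0

/-- Split by the first letter of the list: the maximum of `S` closes the current block, and any of
the `N` other letters prolongs it. -/
theorem sum_X_pow_evenBlocksLength {α : Type*} [LinearOrder α] (N L : ℕ) (S : Finset α)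
    (hS : S.card = N) :
    ∑ l ∈ orderings S, (X : ℚ[X]) ^ evenBlocksLength L l = blockPoly N L := by
  induction N generalizing L S with
  | zero =>
    rw [Finset.card_eq_zero] at hS
    subst hS
    simp [orderings, evenBlocksLength, blockLengths, blockPoly]
  | succ N ih =>
    have hne : S.Nonempty := by rw [← Finset.card_pos]; omega
    rw [sum_orderings S hne, ← Finset.sum_erase_add S _ (S.max'_mem hne), blockPoly]
    congr 1
    · rw [Finset.sum_congr rfl (g := fun _ => blockPoly N (L + 1)), Finset.sum_const,
        Finset.card_erase_of_mem (S.max'_mem hne), hS, nsmul_eq_mul, Nat.add_sub_cancel]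
      intro x hx
      rw [← ih (L + 1) (S.erase x) (by
        rw [Finset.card_erase_of_mem (Finset.mem_of_mem_erase hx), hS, Nat.add_sub_cancel])]
      refine Finset.sum_congr rfl fun l hl => ?_
      have : ∃ z ∈ l, x < z := by
        refine ⟨S.max' hne, ?_, S.lt_max'_of_mem_erase_max' hne hx⟩
        rw [← List.mem_toFinset, (mem_orderings.mp hl).2]
        exact Finset.mem_erase.mpr ⟨(Finset.ne_of_mem_erase hx).symm, S.max'_mem hne⟩
      rw [evenBlocksLength, blockLengths, if_pos this, evenBlocksLength]
    · rw [← ih 0 (S.erase (S.max' hne)) (by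
        rw [Finset.card_erase_of_mem (S.max'_mem hne), hS, Nat.add_sub_cancel]), Finset.mul_sum]
      refine Finset.sum_congr rfl fun l hl => ?_
      have : ¬ ∃ z ∈ l, S.max' hne < z := by
        rintro ⟨z, hz, h⟩
        rw [← List.mem_toFinset, (mem_orderings.mp hl).2] at hz
        exact absurd (S.le_max' z (Finset.mem_of_mem_erase hz)) (not_le.mpr h)
      rw [evenBlocksLength, blockLengths, if_neg this, evenBlocksLength, blockWeight]
      by_cases hL : Even (L + 1)
      · rw [List.filter_cons_of_pos (by simpa using hL), if_pos hL, List.sum_cons, pow_add]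
      · rw [List.filter_cons_of_neg (by simpa using hL), if_neg hL, one_mul]

theorem card_filter_evenBlocksLength {α : Type*} [LinearOrder α] (S : Finset α) (j : ℕ) :
    (((orderings S).filter (evenBlocksLength 0 · = j)).card : ℚ) =
      (blockPoly S.card 0).coeff j := by
  rw [← sum_X_pow_evenBlocksLength S.card 0 S rfl, finsetSum_coeff]
  simp [coeff_X_pow, eq_comm]

/-- Unfolds the recursion until the current block closes: `M` letters precede the maximum, chosen in
`N! / (N - M)!` ways. -/
theorem blockPoly_succ_eq_sum (N L : ℕ) :
    blockPoly (N + 1) L = ∑ M ∈ Finset.range (N + 1),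
      (C ((N ! : ℚ) / ((N - M)! : ℚ))) * (blockWeight (L + M + 1) * blockPoly (N - M) 0) := by
  induction N generalizing L with
  | zero => simp [blockPoly]
  | succ N ih =>
    rw [blockPoly, ih, Finset.sum_range_succ' _ (N + 1), Finset.mul_sum]
    refine congrArg₂ (· + ·) ?_ ?_
    · refine Finset.sum_congr rfl fun M hM => ?_
      rw [← mul_assoc, show L + 1 + M + 1 = L + (M + 1) + 1 by ring, Nat.add_sub_add_right,
        Nat.factorial_succ, ← Polynomial.C_eq_natCast, ← C_mul, Nat.cast_mul, mul_div_assoc]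
    · rw [Nat.sub_zero, div_self (by positivity)]
      simp

/-- The normalised central binomial coefficient `binom(2m, m) / 4 ^ m`. -/
def halfBinom (m : ℕ) : ℚ := ((2 * m - 1)‼ : ℚ) ^ 2 / ((2 * m)! : ℚ)

theorem halfBinom_zero : halfBinom 0 = 1 := by simp [halfBinom]

theorem halfBinom_succ (m : ℕ) : (2 * m + 2) * halfBinom (m + 1) = (2 * m + 1) * halfBinom m := by
  have h : (2 * (m + 1) - 1)‼ = (2 * m + 1) * (2 * m - 1)‼ := by
    -- At `m = 0` truncated subtraction gives `0‼ = 1`, in agreement with `(-1)!! = 1`.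
    cases m with
    | zero => rfl
    | succ m => exact Nat.doubleFactorial_add_two (2 * m + 1)
  have hf : ((2 * (m + 1))! : ℚ) = (2 * m + 2) * ((2 * m + 1) * (2 * m)!) := by
    rw [show 2 * (m + 1) = 2 * m + 1 + 1 by ring, Nat.factorial_succ, Nat.factorial_succ]
    push_cast; ring
  rw [halfBinom, halfBinom, h, hf]
  have := Nat.factorial_ne_zero (2 * m)
  push_cast
  field_simp

/-- The exponential generating function of the permutations with even cycles only. -/
def evenSeries : PowerSeries ℚ := PowerSeries.mk fun n => if Even n then halfBinom (n / 2) else 0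

-- The differential equation of `(1 - x²)^(-1/2)`; on coefficients it is `halfBinom_succ`.
open PowerSeries in
theorem derivative_evenSeries :
    d⁄dX ℚ evenSeries * (1 - PowerSeries.X ^ 2) = PowerSeries.X * evenSeries := by
  ext n
  rw [mul_sub, mul_one, map_sub]
  rcases n with _ | _ | n
  · simp [PowerSeries.coeff_derivative, evenSeries, PowerSeries.coeff_mul_X_pow']
  · have := halfBinom_succ 0
    simp [PowerSeries.coeff_derivative, evenSeries, PowerSeries.coeff_mul_X_pow',
      PowerSeries.coeff_succ_X_mul, halfBinom_zero] at this ⊢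
    linarith
  · rw [PowerSeries.coeff_mul_X_pow _ 2 n, PowerSeries.coeff_derivative,
      PowerSeries.coeff_derivative, PowerSeries.coeff_succ_X_mul]
    simp only [evenSeries, PowerSeries.coeff_mk]
    rcases Nat.even_or_odd' n with ⟨m, rfl | rfl⟩
    · have h1 : ¬ Even (2 * m + 1) := by simp [parity_simps]
      have h2 : ¬ Even (2 * m + 1 + 1 + 1) := by simp [parity_simps]
      simp [h1, h2]
    · have h1 : Even (2 * m + 1 + 1) := by simp [parity_simps]
      have h2 : Even (2 * m + 1 + 1 + 1 + 1) := by simp [parity_simps]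
      have h3 : (2 * m + 1 + 1) / 2 = m + 1 := by omega
      have h4 : (2 * m + 1 + 1 + 1 + 1) / 2 = m + 1 + 1 := by omega
      have := halfBinom_succ (m + 1)
      simp only [h1, h2, h3, h4, if_true]
      push_cast at this ⊢
      linarith

end GeneratingPolynomial

/-! ### Solving the recursion by exponential generating functions -/

section GeneratingPolynomial

open Polynomial

/-- The exponential generating function of the permutations with odd cycles only. -/
noncomputable def oddSeries : PowerSeries ℚ := (1 + PowerSeries.X) * evenSeries

theorem one_sub_X_sq_ne_zero : (1 - PowerSeries.X ^ 2 : PowerSeries ℚ) ≠ 0 := by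
  intro h
  have := congrArg (PowerSeries.coeff 0) h
  simp at this

/-- The logarithmic derivative of the generating function of the nonempty even cycles. -/
def evenCycleSeries : PowerSeries ℚ := PowerSeries.mk fun M => if Even (M + 1) then 1 else 0

/-- The logarithmic derivative of the generating function of the nonempty odd cycles. -/
def oddCycleSeries : PowerSeries ℚ := PowerSeries.mk fun M => if Even (M + 1) then 0 else 1

theorem evenCycleSeries_mul : evenCycleSeries * (1 - PowerSeries.X ^ 2) = PowerSeries.X := by
  ext n
  rw [mul_sub, mul_one, map_sub]
  rcases n with _ | _ | n
  · simp [evenCycleSeries, PowerSeries.coeff_mul_X_pow']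
  · simp [evenCycleSeries, PowerSeries.coeff_mul_X_pow']
  · rw [PowerSeries.coeff_mul_X_pow _ 2 n]
    simp [evenCycleSeries, PowerSeries.coeff_X, parity_simps]

theorem oddCycleSeries_mul : oddCycleSeries * (1 - PowerSeries.X ^ 2) = 1 := by
  ext n
  rw [mul_sub, mul_one, map_sub]
  rcases n with _ | _ | n
  · simp [oddCycleSeries, PowerSeries.coeff_mul_X_pow']
  · simp [oddCycleSeries, PowerSeries.coeff_mul_X_pow', PowerSeries.coeff_one]
  · rw [PowerSeries.coeff_mul_X_pow _ 2 n]
    simp [oddCycleSeries, PowerSeries.coeff_one, parity_simps]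

open PowerSeries in
theorem derivative_evenSeries_eq : d⁄dX ℚ evenSeries = evenSeries * evenCycleSeries := by
  apply mul_right_cancel₀ one_sub_X_sq_ne_zero
  rw [derivative_evenSeries, mul_assoc, evenCycleSeries_mul, mul_comm]

open PowerSeries in
theorem derivative_oddSeries_eq : d⁄dX ℚ oddSeries = oddSeries * oddCycleSeries := by
  apply mul_right_cancel₀ one_sub_X_sq_ne_zero
  rw [mul_assoc, oddCycleSeries_mul, oddSeries, Derivation.leibniz]
  simp only [smul_eq_mul, map_add, Derivation.map_one_eq_zero, PowerSeries.derivative_X]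
  rw [add_mul, mul_assoc, derivative_evenSeries]
  ring

/-- The normalised `blockPoly N 0`, as predicted by the exponential generating function. -/
noncomputable def seriesPoly (N : ℕ) : ℚ[X] :=
  ∑ p ∈ Finset.HasAntidiagonal.antidiagonal N,
    C (evenSeries.coeff p.1 * oddSeries.coeff p.2) * X ^ p.1

/-- The generating function of `seriesPoly`. -/
noncomputable def jointSeries : PowerSeries ℚ[X] :=
  PowerSeries.rescale (X : ℚ[X]) (PowerSeries.map C evenSeries) * PowerSeries.map C oddSeries

theorem coeff_jointSeries (N : ℕ) : PowerSeries.coeff N jointSeries = seriesPoly N := by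
  rw [jointSeries, PowerSeries.coeff_mul, seriesPoly]
  refine Finset.sum_congr rfl fun p _ => ?_
  rw [PowerSeries.coeff_rescale, PowerSeries.coeff_map, PowerSeries.coeff_map, C_mul]
  ring

open PowerSeries in
theorem derivative_map_C (f : PowerSeries ℚ) :
    d⁄dX ℚ[X] (PowerSeries.map (Polynomial.C : ℚ →+* ℚ[X]) f) =
      PowerSeries.map Polynomial.C (d⁄dX ℚ f) := by
  ext1 n
  simp [PowerSeries.coeff_derivative]

open PowerSeries in
theorem derivative_rescale_X (f : PowerSeries ℚ[X]) :
    d⁄dX ℚ[X] (PowerSeries.rescale (Polynomial.X : ℚ[X]) f) =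
      PowerSeries.C (Polynomial.X : ℚ[X]) * PowerSeries.rescale Polynomial.X (d⁄dX ℚ[X] f) := by
  ext1 n
  simp only [PowerSeries.coeff_derivative, PowerSeries.coeff_rescale, PowerSeries.coeff_C_mul]
  ring

open PowerSeries in
theorem powerSeries_derivative_mul {R : Type*} [CommRing R] (f g : PowerSeries R) :
    d⁄dX R (f * g) = f * d⁄dX R g + g * d⁄dX R f := by
  rw [Derivation.leibniz, smul_eq_mul, smul_eq_mul]

-- The logarithmic derivative of `E(tx) O(x)` is `t·e(tx) + o(x)`, with `e` and `o` those of `E` and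
-- `O`. Its coefficient of `x^M` is `t^(M+1)` or `1` according to the parity of `M + 1`.
open PowerSeries in
theorem derivative_jointSeries :
    d⁄dX ℚ[X] jointSeries = jointSeries * PowerSeries.mk fun M => blockWeight (M + 1) := by
  have hw : (PowerSeries.mk fun M => blockWeight (M + 1)) =
      PowerSeries.C (Polynomial.X : ℚ[X]) *
        PowerSeries.rescale Polynomial.X (PowerSeries.map Polynomial.C evenCycleSeries) +
      PowerSeries.map Polynomial.C oddCycleSeries := by
    ext1 M
    simp only [PowerSeries.coeff_mk, map_add, PowerSeries.coeff_C_mul, PowerSeries.coeff_rescale,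
      PowerSeries.coeff_map, evenCycleSeries, oddCycleSeries, blockWeight]
    by_cases h : Even (M + 1)
    · simp only [h, if_true, map_one, map_zero]; ring
    · simp only [h, if_false, map_one, map_zero]; ring
  rw [hw, jointSeries, powerSeries_derivative_mul, derivative_rescale_X, derivative_map_C,
    derivative_map_C, derivative_evenSeries_eq, derivative_oddSeries_eq]
  simp only [map_mul]
  ring

theorem seriesPoly_succ (N : ℕ) : ((N : ℚ[X]) + 1) * seriesPoly (N + 1) =
    ∑ M ∈ Finset.range (N + 1), blockWeight (M + 1) * seriesPoly (N - M) := by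
  have := congrArg (PowerSeries.coeff N) derivative_jointSeries
  rw [PowerSeries.coeff_derivative, coeff_jointSeries, mul_comm jointSeries,
    PowerSeries.coeff_mul, Finset.Nat.sum_antidiagonal_eq_sum_range_succ_mk] at this
  rw [mul_comm, this]
  refine Finset.sum_congr rfl fun M _ => ?_
  rw [PowerSeries.coeff_mk, coeff_jointSeries]

/-- After division by factorials, `blockPoly_succ_eq_sum` at `L = 0` is the recursion
`seriesPoly_succ`. -/
theorem blockPoly_eq (N : ℕ) : blockPoly N 0 = (N ! : ℚ[X]) * seriesPoly N := by
  induction N using Nat.strong_induction_on with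
  | _ N ih =>
    cases N with
    | zero => simp [blockPoly, seriesPoly, evenSeries, oddSeries, halfBinom_zero]
    | succ N =>
      rw [Nat.factorial_succ, Nat.cast_mul, Nat.cast_succ, mul_comm ((N : ℚ[X]) + 1), mul_assoc,
        seriesPoly_succ, blockPoly_succ_eq_sum, Finset.mul_sum]
      refine Finset.sum_congr rfl fun M hM => ?_
      rw [ih (N - M) (by omega), Nat.zero_add, mul_left_comm _ _ (seriesPoly _), ← mul_assoc,
        ← Polynomial.C_eq_natCast, ← C_mul, div_mul_cancel₀ _ (by positivity)]
      rfl

theorem coeff_seriesPoly (i j : ℕ) :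
    (seriesPoly (j + i)).coeff j = evenSeries.coeff j * oddSeries.coeff i := by
  rw [seriesPoly, finsetSum_coeff, Finset.sum_eq_single (j, i)]
  · rw [coeff_C_mul_X_pow, if_pos rfl]
  · rintro ⟨a, b⟩ h hne
    rw [Finset.HasAntidiagonal.mem_antidiagonal] at h
    rw [coeff_C_mul_X_pow, if_neg]
    rintro rfl
    exact hne (by simp_all)
  · simp

theorem coeff_evenSeries (m : ℕ) : evenSeries.coeff (2 * m) = halfBinom m := by
  simp [evenSeries]

/-- In `(1 + X) E` the term `X E` lives in odd degrees only. -/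
theorem coeff_oddSeries (m : ℕ) : oddSeries.coeff (2 * m) = halfBinom m := by
  rw [oddSeries, add_mul, one_mul, map_add, coeff_evenSeries]
  cases m with
  | zero => simp
  | succ m =>
    rw [show 2 * (m + 1) = 2 * m + 1 + 1 by ring, PowerSeries.coeff_succ_X_mul]
    simp [evenSeries, parity_simps]

theorem factorial_mul_halfBinom (m : ℕ) :
    ((2 * m)! : ℚ) * halfBinom m = ((2 * m - 1)‼ : ℚ) ^ 2 := by
  rw [halfBinom, mul_div_cancel₀ _ (by positivity)]

/-- The number of words on `2n` letters whose even blocks have total length `2k`. -/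
theorem card_evenBlocksLength {α : Type*} [LinearOrder α] (S : Finset α) {n k : ℕ}
    (hS : S.card = 2 * n) (hk : k ≤ n) :
    ((orderings S).filter (evenBlocksLength 0 · = 2 * k)).card =
      (2 * n).choose (2 * k) * ((2 * k - 1)‼) ^ 2 * ((2 * n - 2 * k - 1)‼) ^ 2 := by
  obtain ⟨m, rfl⟩ := Nat.exists_eq_add_of_le hk
  rw [← Nat.cast_inj (R := ℚ), card_filter_evenBlocksLength, blockPoly_eq, hS,
    ← Polynomial.C_eq_natCast, coeff_C_mul, mul_add, coeff_seriesPoly, coeff_evenSeries,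
    coeff_oddSeries, Nat.add_sub_cancel_left, Nat.choose_symm_add, Nat.add_choose]
  rw [Nat.cast_mul, Nat.cast_mul, Nat.cast_pow, Nat.cast_pow, ← factorial_mul_halfBinom,
    ← factorial_mul_halfBinom, Nat.cast_div (Nat.factorial_mul_factorial_dvd_factorial_add _ _)
      (by positivity)]
  push_cast
  field_simp

/-- The number of words on `2m` letters all of whose blocks are even. -/
theorem card_blockLengths_even {α : Type*} [LinearOrder α] (S : Finset α) {m : ℕ}
    (hS : S.card = 2 * m) :
    ((orderings S).filter AllBlocksEven).card = ((2 * m - 1)‼) ^ 2 := by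
  -- All blocks are even exactly when the even blocks use up all letters: the case `k = n`.
  have h := card_evenBlocksLength S hS le_rfl
  rw [Nat.sub_self, Nat.choose_self] at h
  rw [show ((2 * m - 1)‼) ^ 2 = 1 * ((2 * m - 1)‼) ^ 2 * ((0 - 1)‼) ^ 2 by simp, ← h]
  congr 1
  refine Finset.filter_congr fun l hl => ?_
  rw [← evenBlocksLength_eq_length_iff, length_of_mem_orderings hl, hS]

end GeneratingPolynomial

/-! ### Cycles as blocks, and bijectivity of the Foata map -/

section Foata

open Equiv.Perm

/-- The cycle of `m`, written as the word `m, σ m, σ (σ m), …`. -/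
noncomputable def cycleBlock {α : Type*} (σ : Equiv.Perm α) (m : α) : List α :=
  List.iterate σ m (Function.minimalPeriod σ m)

theorem minimalPeriod_perm_pos {α : Type*} [Finite α] (σ : Equiv.Perm α) (m : α) :
    0 < Function.minimalPeriod σ m :=
  Function.minimalPeriod_pos_of_mem_periodicPts (σ.injective.mem_periodicPts m)

theorem length_cycleBlock {α : Type*} (σ : Equiv.Perm α) (m : α) :
    (cycleBlock σ m).length = Function.minimalPeriod σ m := by
  rw [cycleBlock, List.length_iterate]

theorem mem_cycleBlock {α : Type*} [Finite α] {σ : Equiv.Perm α} {m x : α} :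
    x ∈ cycleBlock σ m ↔ σ.SameCycle m x := by
  rw [cycleBlock, List.mem_iterate]
  constructor
  · rintro ⟨i, -, rfl⟩
    exact ⟨i, by simp [Equiv.Perm.iterate_eq_pow]⟩
  · intro h
    obtain ⟨i, rfl⟩ := h.exists_nat_pow_eq
    refine ⟨i % Function.minimalPeriod σ m, Nat.mod_lt _ (minimalPeriod_perm_pos σ m), ?_⟩
    rw [Function.iterate_mod_minimalPeriod_eq, Equiv.Perm.iterate_eq_pow]

theorem nodup_cycleBlock {α : Type*} (σ : Equiv.Perm α) (m : α) : (cycleBlock σ m).Nodup := by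
  rw [cycleBlock, ← List.range_map_iterate]
  refine List.Nodup.map_on ?_ List.nodup_range
  intro i hi j hj h
  rw [List.mem_range] at hi hj
  exact Function.iterate_injOn_Iio_minimalPeriod hi hj h

theorem cycleBlock_eq_cons {α : Type*} [Finite α] (σ : Equiv.Perm α) (m : α) :
    ∃ t, cycleBlock σ m = m :: t := by
  rw [cycleBlock]
  obtain ⟨p, hp⟩ := Nat.exists_eq_succ_of_ne_zero (minimalPeriod_perm_pos σ m).ne'
  rw [hp]
  exact ⟨_, rfl⟩

theorem card_support_cycleOf_eq {α : Type*} [Fintype α] [DecidableEq α] (σ : Equiv.Perm α) {m : α}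
    (h : m ∈ σ.support) :
    (σ.cycleOf m).support.card = Function.minimalPeriod σ m := by
  have : (σ.cycleOf m).support = (cycleBlock σ m).toFinset := by
    ext x
    rw [List.mem_toFinset, mem_cycleBlock, mem_support_cycleOf_iff' (mem_support.mp h)]
  rw [this, List.toFinset_card_of_nodup (nodup_cycleBlock σ m), length_cycleBlock]

theorem mem_of_cons_eq_flatMap_cycleBlock {α : Type*} [Finite α] {σ : Equiv.Perm α}
    {ms a : List α} {x : α} (h : ms.flatMap (cycleBlock σ) = x :: a) : x ∈ ms := by
  cases ms with
  | nil => simp at h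
  | cons m ms =>
    obtain ⟨t, ht⟩ := cycleBlock_eq_cons σ m
    rw [List.flatMap_cons, ht, List.cons_append, List.cons.injEq] at h
    simp [h.1]

variable {α : Type*} [LinearOrder α] [Fintype α]

/-- The elements that are the largest of their cycle. -/
noncomputable def cycleMaxima (σ : Equiv.Perm α) : Finset α :=
  Finset.univ.filter fun m : α => ∀ y, σ.SameCycle m y → y ≤ m

theorem foata_eq (σ : Equiv.Perm α) :
    foata σ = ((cycleMaxima σ).sort (· ≤ ·)).flatMap (cycleBlock σ) := rfl

theorem mem_cycleMaxima {σ : Equiv.Perm α} {m : α} :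
    m ∈ cycleMaxima σ ↔ ∀ y, σ.SameCycle m y → y ≤ m := by
  simp [cycleMaxima]

/-- The last cycle maximum exceeds the rest of its cycle and all earlier cycles, so
`blockLengths_append_cons` peels off the last cycle. -/
theorem blockLengths_flatMap_cycleBlock (σ : Equiv.Perm α) (ms : List α)
    (hs : ms.Pairwise (· < ·)) (hm : ∀ m ∈ ms, m ∈ cycleMaxima σ) :
    blockLengths 0 (ms.flatMap (cycleBlock σ)).reverse =
      (ms.map (Function.minimalPeriod σ)).reverse := by
  induction ms using List.reverseRecOn with
  | nil => rfl
  | append_singleton ms m ih =>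
    rw [List.pairwise_append] at hs
    obtain ⟨t, ht⟩ := cycleBlock_eq_cons σ m
    have hnd := nodup_cycleBlock σ m
    have hlen := length_cycleBlock σ m
    rw [ht, List.length_cons] at hlen
    rw [ht, List.nodup_cons] at hnd
    rw [List.flatMap_append, List.map_append, List.flatMap_singleton, List.map_singleton, ht,
      List.reverse_append, List.reverse_append, List.reverse_cons, List.append_assoc,
      List.singleton_append, blockLengths_append_cons,
      ih hs.1 (fun m' h => hm m' (by simp [h])), List.length_reverse, Nat.zero_add, hlen]
    · rfl
    · intro x hx
      rw [List.mem_reverse] at hx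
      refine lt_of_le_of_ne (mem_cycleMaxima.mp (hm m (by simp)) x ?_) ?_
      · rw [← mem_cycleBlock, ht]
        simp [hx]
      · rintro rfl
        exact hnd.1 hx
    · intro y hy
      rw [List.mem_reverse, List.mem_flatMap] at hy
      obtain ⟨m', hm', hy⟩ := hy
      exact (mem_cycleMaxima.mp (hm m' (by simp [hm'])) y (mem_cycleBlock.mp hy)).trans_lt
        (hs.2.2 m' hm' m (by simp))

theorem exists_mem_cycleMaxima (σ : Equiv.Perm α) (x : α) :
    ∃ m ∈ cycleMaxima σ, σ.SameCycle m x := by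
  classical
  have hne : (Finset.univ.filter fun y => σ.SameCycle x y).Nonempty :=
    ⟨x, by simp [SameCycle.refl]⟩
  obtain ⟨m, hm, hmax⟩ := Finset.exists_max_image _ id hne
  simp only [Finset.mem_filter, Finset.mem_univ, true_and, id] at hm hmax
  exact ⟨m, mem_cycleMaxima.mpr fun y hy => hmax y (hm.trans hy), hm.symm⟩

theorem eq_of_mem_cycleMaxima {σ : Equiv.Perm α} {m m' : α} (hm : m ∈ cycleMaxima σ)
    (hm' : m' ∈ cycleMaxima σ) (h : σ.SameCycle m m') : m = m' :=
  le_antisymm (mem_cycleMaxima.mp hm' _ h.symm) (mem_cycleMaxima.mp hm _ h)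

/-- Every nontrivial cycle factor is `σ.cycleOf m` for exactly one cycle maximum `m`; the remaining
maxima are the fixed points, of period `1`. -/
theorem parts_partition_eq [DecidableEq α] (σ : Equiv.Perm α) :
    σ.partition.parts = (cycleMaxima σ).val.map (Function.minimalPeriod σ) := by
  have hfix : (cycleMaxima σ).filter (· ∉ σ.support) = σ.supportᶜ := by
    ext x
    simp only [Finset.mem_filter, Finset.mem_compl, and_iff_right_iff_imp, mem_support, not_not]
    intro hx
    rw [mem_cycleMaxima]
    intro y hy
    exact (hy.eq_of_left hx).symm.le
  have himg : σ.cycleFactorsFinset =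
      ((cycleMaxima σ).filter (· ∈ σ.support)).image (fun m => σ.cycleOf m) := by
    ext c
    simp only [Finset.mem_image, Finset.mem_filter]
    constructor
    · intro hc
      obtain ⟨a, ha⟩ := (mem_cycleFactorsFinset_iff.mp hc).1.nonempty_support
      obtain rfl := cycle_is_cycleOf ha hc
      obtain ⟨m, hm, hma⟩ := exists_mem_cycleMaxima σ a
      rw [← hma.cycleOf_eq] at hc ⊢
      exact ⟨m, ⟨hm, cycleOf_mem_cycleFactorsFinset_iff.mp hc⟩, rfl⟩
    · rintro ⟨m, ⟨-, hm⟩, rfl⟩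
      exact cycleOf_mem_cycleFactorsFinset_iff.mpr hm
  have hinj : Set.InjOn (fun m => σ.cycleOf m) ((cycleMaxima σ).filter (· ∈ σ.support)) := by
    intro m hm m' hm' h
    simp only [Finset.coe_filter, Set.mem_ofPred_eq] at hm hm'
    exact eq_of_mem_cycleMaxima hm.1 hm'.1
      ((sameCycle_iff_cycleOf_eq_of_mem_support hm.2 hm'.2).mpr h)
  rw [parts_partition, cycleType_def, himg, Finset.image_val_of_injOn hinj, Multiset.map_map,
    ← Finset.card_compl, ← hfix]
  have h1 : Multiset.map (Finset.card ∘ support ∘ fun m => σ.cycleOf m)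
      ((cycleMaxima σ).filter (· ∈ σ.support)).val = Multiset.map (Function.minimalPeriod σ)
        ((cycleMaxima σ).filter (· ∈ σ.support)).val :=
    Multiset.map_congr rfl fun m hm =>
      card_support_cycleOf_eq σ (Finset.mem_filter.mp (Finset.mem_val.mp hm)).2
  have h2 : Multiset.replicate ((cycleMaxima σ).filter (· ∉ σ.support)).card 1 =
      Multiset.map (Function.minimalPeriod σ) ((cycleMaxima σ).filter (· ∉ σ.support)).val := by
    rw [Finset.card_def, ← Multiset.map_const']
    refine Multiset.map_congr rfl fun m hm => ?_
    have := (Finset.mem_filter.mp (Finset.mem_val.mp hm)).2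
    rw [notMem_support] at this
    exact (Function.minimalPeriod_eq_one_iff_isFixedPt.mpr this).symm
  rw [h2, Function.comp_assoc, h1, ← Multiset.map_add, Finset.filter_val, Finset.filter_val,
    Multiset.filter_add_not]

theorem blockLengths_foata [DecidableEq α] (σ : Equiv.Perm α) :
    (blockLengths 0 (foata σ).reverse : Multiset ℕ) = σ.partition.parts := by
  rw [foata_eq, blockLengths_flatMap_cycleBlock σ _ (Finset.sortedLT_sort _).pairwise
    (fun m hm => (Finset.mem_sort _).mp hm), Multiset.coe_reverse, parts_partition_eq,
    ← Multiset.map_coe, Finset.sort_eq]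

theorem foata_mem_orderings (σ : Equiv.Perm α) : foata σ ∈ orderings Finset.univ := by
  have hmem : (foata σ).toFinset = Finset.univ := by
    refine Finset.eq_univ_of_forall fun x => ?_
    obtain ⟨m, hm, h⟩ := exists_mem_cycleMaxima σ x
    rw [List.mem_toFinset, foata_eq, List.mem_flatMap]
    exact ⟨m, (Finset.mem_sort _).mpr hm, mem_cycleBlock.mpr h⟩
  -- The cycle lengths sum to the size of `α`. As every element occurs, none can occur twice.
  have hlen : (foata σ).length = Fintype.card α := by
    rw [← List.length_reverse, ← sum_blockLengths, ← Multiset.sum_coe, blockLengths_foata,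
      σ.partition.parts_sum]
  refine mem_orderings.mpr ⟨?_, hmem⟩
  rw [← Multiset.coe_nodup, ← Multiset.toFinset_card_eq_card_iff_nodup]
  change (foata σ).toFinset.card = (foata σ).length
  rw [hmem, hlen, Finset.card_univ]

/-- The first blocks share their first letter `m`. If one were shorter, the letter after it would
start a new cycle, hence exceed `m`, yet lie in the other word's block of `m`, hence be at most `m`.
-/
theorem cycleBlock_eq_of_flatMap_eq {σ τ : Equiv.Perm α} {ms ms' : List α}
    (hs : ms.Pairwise (· < ·)) (hs' : ms'.Pairwise (· < ·))
    (hm : ∀ m ∈ ms, m ∈ cycleMaxima σ) (hm' : ∀ m ∈ ms', m ∈ cycleMaxima τ)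
    (h : ms.flatMap (cycleBlock σ) = ms'.flatMap (cycleBlock τ)) :
    ∀ m ∈ ms, cycleBlock σ m = cycleBlock τ m := by
  induction ms generalizing ms' with
  | nil => simp
  | cons m ms ih =>
    obtain ⟨t, ht⟩ := cycleBlock_eq_cons σ m
    cases ms' with
    | nil => simp [ht] at h
    | cons m' ms' =>
      obtain ⟨t', ht'⟩ := cycleBlock_eq_cons τ m'
      have hmm : m = m' := by
        rw [List.flatMap_cons, List.flatMap_cons, ht, ht', List.cons_append, List.cons_append,
          List.cons.injEq] at h
        exact h.1
      subst hmm
      rw [List.pairwise_cons] at hs hs'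
      rw [List.flatMap_cons, List.flatMap_cons] at h
      have key : cycleBlock σ m = cycleBlock τ m ∧
          ms.flatMap (cycleBlock σ) = ms'.flatMap (cycleBlock τ) := by
        rcases List.append_eq_append_iff.mp h with ⟨a, ha, hb⟩ | ⟨a, ha, hb⟩
        · cases a with
          | nil => exact ⟨by simpa using ha.symm, by simpa using hb⟩
          | cons x a =>
            have h1 := hs.1 x (mem_of_cons_eq_flatMap_cycleBlock hb)
            have h2 := mem_cycleMaxima.mp (hm' m (by simp)) x
              (mem_cycleBlock.mp (by rw [ha]; simp))
            exact absurd h1 (not_lt.mpr h2)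
        · cases a with
          | nil => exact ⟨by simpa using ha, by simpa using hb.symm⟩
          | cons x a =>
            have h1 := hs'.1 x (mem_of_cons_eq_flatMap_cycleBlock hb)
            have h2 := mem_cycleMaxima.mp (hm m (by simp)) x
              (mem_cycleBlock.mp (by rw [ha]; simp))
            exact absurd h1 (not_lt.mpr h2)
      intro m₁ hm₁
      rcases List.mem_cons.mp hm₁ with rfl | hm₁
      · exact key.1
      · exact ih hs.2 hs'.2 (fun m h => hm m (by simp [h])) (fun m h => hm' m (by simp [h]))
          key.2 m₁ hm₁

theorem foata_injective : Function.Injective (foata : Equiv.Perm α → List α) := by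
  intro σ τ h
  have key := cycleBlock_eq_of_flatMap_eq (Finset.sortedLT_sort (cycleMaxima σ)).pairwise
    (Finset.sortedLT_sort (cycleMaxima τ)).pairwise (fun m hm => (Finset.mem_sort _).mp hm)
    (fun m hm => (Finset.mem_sort _).mp hm) h
  ext x
  obtain ⟨m, hm, hx⟩ := exists_mem_cycleMaxima σ x
  have hb := key m ((Finset.mem_sort _).mpr hm)
  have hp : Function.minimalPeriod σ m = Function.minimalPeriod τ m := by
    rw [← length_cycleBlock, hb, length_cycleBlock]
  -- The endpoint, where both iterates return to `m`, gives the image of the last letter of the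
  -- block.
  have hit : ∀ i ≤ Function.minimalPeriod σ m, σ^[i] m = τ^[i] m := by
    intro i hi
    rcases hi.lt_or_eq with hi | rfl
    · have := congrArg (·[i]?) hb
      simpa [cycleBlock, List.getElem?_iterate, hi, ← hp] using this
    · rw [Function.iterate_minimalPeriod, hp, Function.iterate_minimalPeriod]
  rw [← mem_cycleBlock, cycleBlock, List.mem_iterate] at hx
  obtain ⟨i, hi, rfl⟩ := hx
  rw [← Function.iterate_succ_apply' σ, hit _ hi, hit _ hi.le, Function.iterate_succ_apply']

/-- Surjectivity follows from injectivity, as there are `|α|!` permutations and equally many words.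
-/
theorem image_foata : Finset.univ.image (foata : Equiv.Perm α → List α) =
    orderings Finset.univ := by
  refine Finset.eq_of_subset_of_card_le ?_ ?_
  · intro l hl
    obtain ⟨σ, -, rfl⟩ := Finset.mem_image.mp hl
    exact foata_mem_orderings σ
  · rw [card_orderings, Finset.card_image_of_injective _ foata_injective, Finset.card_univ,
      Finset.card_univ, Fintype.card_perm]

end Foata

/-! ### Uniqueness of the watershed, and the two counts -/

section Watershed

theorem map_val_mem_orderings {α : Type*} [LinearOrder α] {S : Finset α} {l : List S} :
    l.map Subtype.val ∈ orderings S ↔ l ∈ orderings Finset.univ := by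
  rw [mem_orderings, mem_orderings, List.nodup_map_iff Subtype.val_injective]
  refine and_congr_right fun _ => ?_
  simp only [Finset.ext_iff, List.mem_toFinset, List.mem_map, Subtype.exists, exists_and_right,
    exists_eq_right, Finset.mem_univ, iff_true, Subtype.forall]
  exact ⟨fun h x hx => ((h x).mpr hx).2, fun h x => ⟨fun h' => h'.1, fun hx => ⟨hx, h x hx⟩⟩⟩

/-- The words on `S` are the images of the permutations of `S` under the Foata map. -/
theorem exists_foata_eq {α : Type*} [LinearOrder α] {S : Finset α} {ρ : List α}
    (h : ρ ∈ orderings S) : ∃ σ : Equiv.Perm S, (foata σ).map Subtype.val = ρ := by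
  have hmem : ∀ x ∈ ρ, x ∈ S := fun x hx => by
    rw [← (mem_orderings.mp h).2]
    exact List.mem_toFinset.mpr hx
  lift ρ to List S using hmem
  rw [map_val_mem_orderings, ← image_foata, Finset.mem_image] at h
  obtain ⟨σ, -, rfl⟩ := h
  exact ⟨σ, rfl⟩

theorem parts_partition_eq_blockLengths {α : Type*} [LinearOrder α] {S : Finset α}
    [DecidableEq S] {ρ : List α} {σ : Equiv.Perm S} (h : (foata σ).map Subtype.val = ρ) :
    σ.partition.parts = (blockLengths 0 ρ.reverse : Multiset ℕ) := by
  rw [← h, ← List.map_reverse, blockLengths_map (Subtype.strictMono_coe _), blockLengths_foata]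

theorem foataInvEven_iff {ρ : List ℤ} (h : ρ.Nodup) :
    FoataInvEven ρ ↔ AllBlocksEven ρ.reverse := by
  have key : ∀ σ : Equiv.Perm ρ.toFinset, (foata σ).map Subtype.val = ρ →
      (AllCyclesEven σ ↔ AllBlocksEven ρ.reverse) := by
    intro σ hσ
    rw [AllCyclesEven, parts_partition_eq_blockLengths hσ]
    simp only [Multiset.mem_coe, AllBlocksEven]
  constructor
  · rintro ⟨σ, hσ, he⟩
    exact (key σ hσ).mp he
  · intro he
    obtain ⟨σ, hσ⟩ := exists_foata_eq (mem_orderings.mpr ⟨h, rfl⟩ : ρ ∈ orderings ρ.toFinset)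
    exact ⟨σ, hσ, (key σ hσ).mpr he⟩

theorem evenSplit_iff {π : List ℤ} (h : π.Nodup) (k : ℕ) : EvenSplit π k ↔ 2 * k ≤ π.length ∧
    AllBlocksEven (π.take (2 * k)) ∧
      AllBlocksEven (π.drop (2 * k)).reverse := by
  rw [EvenSplit, foataInvEven_iff (List.nodup_reverse.mpr (h.sublist (List.take_sublist _ _))),
    foataInvEven_iff (h.sublist (List.drop_sublist _ _)), List.reverse_reverse]

theorem exists_eq_append_max_append {α : Type*} [LinearOrder α] {l : List α} (hl : l.Nodup)
    (hne : l ≠ []) :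
    ∃ u m v, l = u ++ m :: v ∧ (∀ x ∈ u, x < m) ∧ ∀ y ∈ v, y < m := by
  obtain ⟨m, hm, hmax⟩ := Finset.exists_max_image l.toFinset id
    (List.toFinset_nonempty_iff l |>.mpr hne)
  rw [List.mem_toFinset] at hm
  obtain ⟨u, v, rfl⟩ := List.append_of_mem hm
  rw [List.nodup_append] at hl
  refine ⟨u, m, v, rfl, fun x hx => lt_of_le_of_ne (hmax x (by simp [hx])) ?_,
    fun y hy => lt_of_le_of_ne (hmax y (by simp [hy])) ?_⟩
  · exact hl.2.2 x hx m (by simp)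
  · rintro rfl
    exact (List.nodup_cons.mp hl.2.1).1 hy

/-- Write `π = a s b` with cuts at `2j` and `2k`, and `s = u m v` with `m` its maximum. The split at
`k` makes `|a| + |u| + 1` even, the split at `j` makes `|b| + |v| + 1` even. As `|a|` and `|b|` are
even, `|u|` and `|v|` are odd, so `|s| = |u| + 1 + |v|` is odd, although it equals `2k - 2j`. -/
theorem EvenSplit.not_lt {π : List ℤ} (h : π.Nodup) (hev : Even π.length) {j k : ℕ}
    (hj : EvenSplit π j) (hk : EvenSplit π k) : ¬ j < k := by
  intro hjk
  rw [evenSplit_iff h] at hj hk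
  obtain ⟨-, -, hj⟩ := hj
  obtain ⟨hlen, hk, -⟩ := hk
  obtain ⟨d, rfl⟩ := Nat.exists_eq_add_of_lt hjk
  set a := π.take (2 * j)
  set s := (π.drop (2 * j)).take (2 * (d + 1)) with hs
  set b := (π.drop (2 * j)).drop (2 * (d + 1)) with hb
  have hdrop : π.drop (2 * j) = s ++ b := (List.take_append_drop _ _).symm
  have htake : π.take (2 * (j + d + 1)) = a ++ s := by
    rw [show 2 * (j + d + 1) = 2 * j + 2 * (d + 1) by ring, List.take_add]
  have hsl : s.length = 2 * (d + 1) := by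
    rw [hs, List.length_take, List.length_drop]
    omega
  have hal : a.length = 2 * j := by
    rw [List.length_take]
    omega
  have hbl : b.length = π.length - 2 * j - 2 * (d + 1) := by
    rw [hb, List.length_drop, List.length_drop]
  have hsn : s.Nodup := h.sublist ((List.take_sublist _ _).trans (List.drop_sublist _ _))
  obtain ⟨u, m, v, he, hu, hv⟩ := exists_eq_append_max_append hsn
    (by rintro h0; simp [h0] at hsl)
  rw [htake, he, ← List.append_assoc] at hk
  rw [hdrop, he, List.reverse_append, List.reverse_append, List.reverse_cons, List.append_assoc,
    List.singleton_append, ← List.append_assoc] at hj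
  have h1 := even_of_blockLengths_even _ _ _ hv hk
  have h2 := even_of_blockLengths_even _ _ _ (by simpa using hu) hj
  rw [he] at hsl
  simp only [List.length_append, List.length_cons, List.length_reverse] at h1 h2 hsl
  rw [Nat.even_iff] at h1 h2 hev
  omega

theorem isWatershed_iff {π : List ℤ} (h : π.Nodup) (hev : Even π.length) (k : ℕ) :
    IsWatershed π k ↔ EvenSplit π k := by
  refine ⟨fun h' => h'.1, fun h' => ⟨h', fun j hj => ?_⟩⟩
  exact le_antisymm (not_lt.mp (h'.not_lt h hev hj)) (not_lt.mp (hj.not_lt h hev h'))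

/-- Splitting the words on `S` after `r` letters. -/
theorem card_orderings_take_drop {α : Type*} [LinearOrder α] (S : Finset α) (r : ℕ)
    (hr : r ≤ S.card) (P Q : List α → Prop) [DecidablePred P] [DecidablePred Q] :
    ((orderings S).filter fun π => P (π.take r) ∧ Q (π.drop r)).card =
      ∑ A ∈ S.powersetCard r, ((orderings A).filter P).card *
        ((orderings (S \ A)).filter Q).card := by
  simp only [← Finset.card_product]
  rw [← Finset.card_sigma]
  refine Finset.card_bij (fun π _ => ⟨(π.take r).toFinset, π.take r, π.drop r⟩) ?_ ?_ ?_
  · intro π hπ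
    rw [Finset.mem_filter] at hπ
    obtain ⟨hmem, hP, hQ⟩ := hπ
    have hlen := length_of_mem_orderings hmem
    rw [mem_orderings] at hmem
    obtain ⟨hn, rfl⟩ := hmem
    have hn' := hn
    rw [← List.take_append_drop r π, List.nodup_append'] at hn'
    simp only [Finset.mem_sigma, Finset.mem_powersetCard, Finset.mem_product, Finset.mem_filter,
      mem_orderings]
    refine ⟨⟨?_, ?_⟩, ⟨⟨hn'.1, trivial⟩, hP⟩, ⟨hn'.2.1, ?_⟩, hQ⟩
    · intro x hx
      rw [List.mem_toFinset] at hx ⊢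
      exact List.mem_of_mem_take hx
    · rw [List.toFinset_card_of_nodup hn'.1, List.length_take]
      omega
    · ext x
      have hx : x ∈ π ↔ x ∈ π.take r ∨ x ∈ π.drop r := by
        rw [← List.mem_append, List.take_append_drop]
      have := @hn'.2.2 x
      simp only [Finset.mem_sdiff, List.mem_toFinset]
      tauto
  · intro π _ π' _ h
    simp only [Sigma.mk.injEq, heq_eq_eq, Prod.mk.injEq] at h
    rw [← List.take_append_drop r π, h.2.1, h.2.2, List.take_append_drop]
  · rintro ⟨A, l, l'⟩ h
    simp only [Finset.mem_sigma, Finset.mem_powersetCard, Finset.mem_product,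
      Finset.mem_filter] at h
    obtain ⟨⟨hA, hc⟩, ⟨hl, hP⟩, hl', hQ⟩ := h
    have hlen := length_of_mem_orderings hl
    rw [mem_orderings] at hl hl'
    have ht : (l ++ l').take r = l := List.take_left' (hlen.trans hc)
    have hd : (l ++ l').drop r = l' := List.drop_left' (hlen.trans hc)
    refine ⟨l ++ l', ?_, ?_⟩
    · rw [Finset.mem_filter, mem_orderings, ht, hd, List.nodup_append', List.toFinset_append, hl.2,
        hl'.2, Finset.union_sdiff_of_subset hA]
      refine ⟨⟨⟨hl.1, hl'.1, ?_⟩, rfl⟩, hP, hQ⟩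
      intro x hx hx'
      rw [← List.mem_toFinset, hl.2] at hx
      rw [← List.mem_toFinset, hl'.2, Finset.mem_sdiff] at hx'
      exact hx'.2 hx
    · rw [ht, hd, hl.2]

theorem card_filter_orderings_reverse {α : Type*} [LinearOrder α] (S : Finset α)
    (P : List α → Prop) [DecidablePred P] :
    ((orderings S).filter fun l => P l.reverse).card = ((orderings S).filter P).card := by
  refine Finset.card_bij (fun l _ => l.reverse) ?_ ?_ ?_
  · intro l hl
    rw [Finset.mem_filter] at hl ⊢
    exact ⟨reverse_mem_orderings.mpr hl.1, hl.2⟩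
  · intro l _ l' _ h
    exact List.reverse_injective h
  · intro l hl
    rw [Finset.mem_filter] at hl
    exact ⟨l.reverse, by simpa [reverse_mem_orderings] using hl, l.reverse_reverse⟩

theorem ncard_isWatershed (S : Finset ℤ) {n k : ℕ} (hS : S.card = 2 * n) (hk : k ≤ n) :
    {π : List ℤ | IsLinearOrdering S π ∧ IsWatershed π k}.ncard =
      (2 * n).choose (2 * k) * ((2 * k - 1)‼) ^ 2 * ((2 * n - 2 * k - 1)‼) ^ 2 := by
  have hset : {π : List ℤ | IsLinearOrdering S π ∧ IsWatershed π k} =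
      ((orderings S).filter fun π : List ℤ => AllBlocksEven (π.take (2 * k)) ∧
        AllBlocksEven (π.drop (2 * k)).reverse : Finset (List ℤ)) := by
    ext π
    rw [Finset.mem_coe, Finset.mem_filter]
    change IsLinearOrdering S π ∧ _ ↔ _
    have hiff : IsLinearOrdering S π ↔ π ∈ orderings S := mem_orderings.symm
    rw [hiff]
    refine and_congr_right fun hπ => ?_
    have hlen := length_of_mem_orderings hπ
    have hnd := (mem_orderings.mp hπ).1
    rw [isWatershed_iff hnd (by rw [hlen, hS]; exact even_two_mul n), evenSplit_iff hnd,
      and_iff_right (by omega)]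
  -- Every set of `2k` first letters contributes the same product, so the sum is a binomial multiple
  -- of it.
  rw [hset, Set.ncard_coe_finset,
    card_orderings_take_drop S (2 * k) (by omega) AllBlocksEven
      (fun l => AllBlocksEven l.reverse),
    Finset.sum_congr rfl
      (g := fun _ => ((2 * k - 1)‼) ^ 2 * ((2 * n - 2 * k - 1)‼) ^ 2),
    Finset.sum_const, Finset.card_powersetCard, hS, smul_eq_mul, mul_assoc]
  intro A hA
  rw [Finset.mem_powersetCard] at hA
  rw [card_filter_orderings_reverse _ AllBlocksEven,
    card_blockLengths_even A hA.2, card_blockLengths_even (m := n - k), Nat.mul_sub]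
  rw [Finset.card_sdiff_of_subset hA.1, hS, hA.2, Nat.mul_sub]

theorem ncard_evenCyclesTotalLength (S : Finset ℤ) {n k : ℕ} (hS : S.card = 2 * n) (hk : k ≤ n) :
    {σ : Equiv.Perm S | evenCyclesTotalLength σ = 2 * k}.ncard =
      (2 * n).choose (2 * k) * ((2 * k - 1)‼) ^ 2 * ((2 * n - 2 * k - 1)‼) ^ 2 := by
  rw [← card_evenBlocksLength S hS hk,
    ← card_filter_orderings_reverse S (fun l => evenBlocksLength 0 l = 2 * k),
    ← Set.ncard_coe_finset]
  have htot : ∀ σ : Equiv.Perm S, evenCyclesTotalLength σ =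
      evenBlocksLength 0 ((foata σ).map Subtype.val).reverse := by
    intro σ
    rw [evenCyclesTotalLength, parts_partition_eq_blockLengths rfl, evenBlocksLength,
      Multiset.filter_coe, Multiset.sum_coe]
  refine Set.ncard_congr (fun σ _ => (foata σ).map Subtype.val) ?_ ?_ ?_
  · intro σ hσ
    rw [Finset.mem_coe, Finset.mem_filter, map_val_mem_orderings, ← htot]
    exact ⟨foata_mem_orderings σ, hσ⟩
  · intro σ τ _ _ h
    exact foata_injective (List.map_injective_iff.mpr Subtype.val_injective h)
  · intro ρ hρ
    rw [Finset.mem_coe, Finset.mem_filter] at hρ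
    obtain ⟨σ, rfl⟩ := exists_foata_eq hρ.1
    exact ⟨σ, (htot σ).trans hρ.2, rfl⟩

end Watershed

theorem mainTheorem3 (n k : ℕ) (hk : k ≤ n) :
    {π : List ℤ | IsLinearOrdering (Finset.Icc (1 : ℤ) (2 * n)) π ∧ IsWatershed π k}.ncard =
        (2 * n).choose (2 * k) * ((2 * k - 1)‼) ^ 2 * ((2 * n - 2 * k - 1)‼) ^ 2 ∧
      {π : List ℤ | IsLinearOrdering (Finset.Icc (1 : ℤ) (2 * n)) π ∧ IsWatershed π k}.ncard =
        {σ : Equiv.Perm (Finset.Icc (1 : ℤ) (2 * n)) |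
          evenCyclesTotalLength σ = 2 * k}.ncard := by
  have hS : (Finset.Icc (1 : ℤ) (2 * n)).card = 2 * n := by
    rw [Int.card_Icc]
    omega
  exact ⟨ncard_isWatershed _ hS hk,
    (ncard_isWatershed _ hS hk).trans (ncard_evenCyclesTotalLength _ hS hk).symm⟩
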